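/- Let $I=[a,b)$ be a bounded interval in $\mathbb{R}$ with $a<b$, and let $\mathcal{D}(I)$ be the family of its dyadic subintervals, that is, of all half-open intervals obtained from $I$ by repeated halving, $I$ included. For $J\in\mathcal{D}(I)$ write $|J|$ for its length and $\langle f\rangle_J=\frac1{|J|}\int_J f$. Let $t>0$, $\lambda>0$ and $0<A\le 1$. Then \[ \sup \frac{1}{|I|}\Bigl|\Bigl\{x\in I:\ \sum_{J\in\mathcal{D}(I)}\alpha_J\langle f\rangle_J\mathbf{1}_J(x)>\lambda\Bigr\}\Bigr|= \begin{cases} \dfrac{2At}{A\lambda+t} & \text{if } t\le A\lambda\le\lambda,\\[2mm] \sqrt{\dfrac{At}{\lambda}} & \text{if } A\le\min\bigl(\tfrac{t}{\lambda},\tfrac{\lambda}{t}\bigr),\\[2mm] 1 & \text{otherwise,} \end{cases} \] where the supremum is taken over all nonnegative integrable functions $f$ on $I$ with $\langle f\rangle_I=t$ and all nonnegative sequences $(\alpha_J)_{J\in\mathcal{D}(I)}$ with Carleson constant at most $1$, that is, \[ \sup_{J\in\mathcal{D}(I)}\frac{1}{|J|}\sum_{K\in\mathcal{D}(J)}\alpha_K|K|\le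 1, \qquad\text{and with}\qquad \frac{1}{|I|}\sum_{J\in\mathcal{D}(I)}\alpha_J|J|=A . \] (In the overlap $t=A\lambda$ of the first two cases the two formulas agree.) -/

import Mathlib

open MeasureTheory
open scoped ENNReal

noncomputable section

namespace LernerOperator

/-- Endpoints of the dyadic subinterval of `[a, b)` with address `w`: starting from `[a, b)`, read
`w` from left to right, passing to the left half at `false` and to the right half at `true`.
Every dyadic subinterval has exactly one address when `a < b`; the empty address is `[a, b)`. -/
def endpoints : ℝ → ℝ → List Bool → ℝ × ℝ
  | a, b, [] => (a, b)
  | a, b, false :: w => endpoints a ((a + b) / 2) w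
  | a, b, true :: w => endpoints ((a + b) / 2) b w

/-- The dyadic subinterval of `[a, b)` with address `J`. The dyadic subintervals of this interval,
itself included, are those with address `J ++ K`, for `K` an arbitrary address. -/
def dyadicInterval (a b : ℝ) (J : List Bool) : Set ℝ :=
  Set.Ico (endpoints a b J).1 (endpoints a b J).2

/-- `(1 / |J|) ∑ α_K |K|`, the sum over all dyadic subintervals `K` of `J`. -/
def normalizedMass (a b : ℝ) (α : List Bool → ℝ) (J : List Bool) : ℝ≥0∞ :=
  (∑' K : List Bool, ENNReal.ofReal (α (J ++ K)) * volume (dyadicInterval a b (J ++ K))) /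
    volume (dyadicInterval a b J)

/-- The Carleson constant of a nonnegative sequence `α` indexed by the dyadic subintervals
of `[a, b)`. -/
def carlesonConstant (a b : ℝ) (α : List Bool → ℝ) : ℝ≥0∞ :=
  ⨆ J : List Bool, normalizedMass a b α J

/-- `∑ α_J ⟨f⟩_J 1_J(x)`, the sum over all dyadic subintervals `J` of `[a, b)`; for nonnegative
`α` and `f` it is a series of nonnegative terms with value in `[0, ∞]`. -/
def lernerOp (a b : ℝ) (α : List Bool → ℝ) (f : ℝ → ℝ) (x : ℝ) : ℝ≥0∞ :=
  ∑' J : List Bool, (dyadicInterval a b J).indicator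
    (fun _ => ENNReal.ofReal (α J * ⨍ y in dyadicInterval a b J, f y)) x

/-- The pairs `(f, α)` over which the supremum is taken: `f` is nonnegative and integrable on
`[a, b)` with average `t`, and `α` is nonnegative with Carleson constant at most `1` and
normalized total mass `A`. -/
def Admissible (a b t A : ℝ) (f : ℝ → ℝ) (α : List Bool → ℝ) : Prop :=
  (∀ x ∈ Set.Ico a b, 0 ≤ f x) ∧ IntegrableOn f (Set.Ico a b) ∧ (⨍ x in Set.Ico a b, f x) = t ∧
    (∀ J, 0 ≤ α J) ∧ carlesonConstant a b α ≤ 1 ∧ normalizedMass a b α [] = ENNReal.ofReal A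

end LernerOperator

end

namespace LernerOperator

/-! The problem is self-similar, which makes it a Bellman function problem in three variables: the
average t, the mass A and the level lam. Passing from an interval to its halves does two things. The
top coefficient c lowers the mass to A - c and the level to lam - c * t; then (t, A - c) splits as
the midpoint of the data of the two halves, with the level fixed. The candidate is `bellman`, the
minimum of 1 and `mixedMean (t / lam) A`.

Upper bound: any nonnegative function that is midpoint concave in (t, A), does not increase under
the jump (t, A, lam) ↦ (t, A - c, lam - c * t), and equals 1 once lam ≤ A * t, dominates the
proportion of the level set, by induction on the depth of a truncated sequence. These properties are
`bellman_midpoint`, `bellman_jump` and `bellman_eq_one`; monotone convergence removes the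
truncation.

Lower bound: the attainable proportions are closed under the same two moves (`Attained.midpoint`,
`Attained.jump`), and a constant function attains 1 when lam < A * t. Concentrating constant data on
part of the interval gives the geometric mean. The harmonic mean comes from the case A = 1, by
alternating small jumps with small concentrations: in the limit lam + t is conserved while t grows,
until the level meets the average (`approached_iterate`). Scaling by A gives the remaining masses.
-/

/-! ### Recursion of the operator, the mass and the Carleson condition over the two halves -/

theorem tsum_list_bool (F : List Bool → ℝ≥0∞) :
    ∑' J, F J = F [] + (∑' J, F (false :: J) + ∑' J, F (true :: J)) := by
  let e : Unit ⊕ (List Bool ⊕ List Bool) ≃ List Bool :=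
    { toFun := Sum.elim (fun _ => []) (Sum.elim (List.cons false) (List.cons true))
      invFun := fun
        | [] => Sum.inl ()
        | false :: J => Sum.inr (Sum.inl J)
        | true :: J => Sum.inr (Sum.inr J)
      left_inv := by rintro (_ | _ | _) <;> rfl
      right_inv := by rintro (_ | ⟨_ | _, _⟩) <;> rfl }
  rw [← e.tsum_eq, ENNReal.summable.tsum_sum ENNReal.summable,
    ENNReal.summable.tsum_sum ENNReal.summable]
  simp [e]

theorem endpoints_lt {a b : ℝ} (hab : a < b) (J : List Bool) :
    (endpoints a b J).1 < (endpoints a b J).2 := by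
  induction J generalizing a b with
  | nil => exact hab
  | cons c J ih => cases c <;> exact ih (by linarith)

theorem dyadicInterval_subset {a b : ℝ} (hab : a < b) (J : List Bool) :
    dyadicInterval a b J ⊆ Set.Ico a b := by
  induction J generalizing a b with
  | nil => exact subset_rfl
  | cons c J ih =>
    cases c
    · exact (ih (a := a) (b := (a + b) / 2) (by linarith)).trans
        (Set.Ico_subset_Ico_right (by linarith))
    · exact (ih (a := (a + b) / 2) (b := b) (by linarith)).trans
        (Set.Ico_subset_Ico_left (by linarith))

theorem volume_dyadicInterval_ne_zero {a b : ℝ} (hab : a < b) (J : List Bool) :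
    volume (dyadicInterval a b J) ≠ 0 := by
  simpa [dyadicInterval] using endpoints_lt hab J

theorem volume_dyadicInterval_ne_top (a b : ℝ) (J : List Bool) :
    volume (dyadicInterval a b J) ≠ ∞ := by
  simp [dyadicInterval]

theorem lernerOp_of_notMem {a b x : ℝ} (hab : a < b) (hx : x ∉ Set.Ico a b) (α : List Bool → ℝ)
    (f : ℝ → ℝ) : lernerOp a b α f x = 0 := by
  refine ENNReal.tsum_eq_zero.2 fun J => Set.indicator_of_notMem ?_ _
  exact fun h => hx (dyadicInterval_subset hab J h)

/-- The operator splits into its top term and the operators of the two halves. -/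
theorem lernerOp_eq {a b x : ℝ} (hx : x ∈ Set.Ico a b) (α : List Bool → ℝ) (f : ℝ → ℝ) :
    lernerOp a b α f x = ENNReal.ofReal (α [] * ⨍ y in Set.Ico a b, f y) +
      (lernerOp a ((a + b) / 2) (fun J => α (false :: J)) f x +
        lernerOp ((a + b) / 2) b (fun J => α (true :: J)) f x) := by
  unfold lernerOp
  rw [tsum_list_bool]
  congr 1
  exact Set.indicator_of_mem hx _

theorem lernerOp_left {a b x : ℝ} (hab : a < b) (hx : x ∈ Set.Ico a ((a + b) / 2))
    (α : List Bool → ℝ) (f : ℝ → ℝ) :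
    lernerOp a b α f x = ENNReal.ofReal (α [] * ⨍ y in Set.Ico a b, f y) +
      lernerOp a ((a + b) / 2) (fun J => α (false :: J)) f x := by
  rw [lernerOp_eq ⟨hx.1, by linarith [hx.2]⟩,
    lernerOp_of_notMem (a := (a + b) / 2) (b := b) (by linarith) (fun h => by linarith [hx.2, h.1]),
    add_zero]

theorem lernerOp_right {a b x : ℝ} (hab : a < b) (hx : x ∈ Set.Ico ((a + b) / 2) b)
    (α : List Bool → ℝ) (f : ℝ → ℝ) :
    lernerOp a b α f x = ENNReal.ofReal (α [] * ⨍ y in Set.Ico a b, f y) +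
      lernerOp ((a + b) / 2) b (fun J => α (true :: J)) f x := by
  rw [lernerOp_eq ⟨by linarith [hx.1], hx.2⟩,
    lernerOp_of_notMem (a := a) (b := (a + b) / 2) (by linarith) (fun h => by linarith [hx.1, h.2]),
    zero_add]

theorem lernerOp_congr {a b : ℝ} (hab : a < b) (α : List Bool → ℝ) {f g : ℝ → ℝ}
    (h : Set.EqOn f g (Set.Ico a b)) : lernerOp a b α f = lernerOp a b α g := by
  ext x
  refine tsum_congr fun J => ?_
  have : ⨍ y in dyadicInterval a b J, f y = ⨍ y in dyadicInterval a b J, g y := by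
    rw [setAverage_eq, setAverage_eq, setIntegral_congr_fun (s := dyadicInterval a b J)
      measurableSet_Ico (h.mono (dyadicInterval_subset hab J))]
  rw [this]

theorem normalizedMass_nil {a b : ℝ} (hab : a < b) (α : List Bool → ℝ) :
    normalizedMass a b α [] = ENNReal.ofReal (α []) +
      (normalizedMass a ((a + b) / 2) (fun J => α (false :: J)) [] +
        normalizedMass ((a + b) / 2) b (fun J => α (true :: J)) []) / 2 := by
  have h0 : volume (dyadicInterval a b []) ≠ 0 := volume_dyadicInterval_ne_zero hab []
  have ht := volume_dyadicInterval_ne_top a b []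
  have e : volume (dyadicInterval a b []) = ENNReal.ofReal (b - a) := Real.volume_Ico
  have el : volume (dyadicInterval a ((a + b) / 2) []) = ENNReal.ofReal ((b - a) / 2) := by
    rw [dyadicInterval, endpoints, Real.volume_Ico]; congr 1; ring
  have er : volume (dyadicInterval ((a + b) / 2) b []) = ENNReal.ofReal ((b - a) / 2) := by
    rw [dyadicInterval, endpoints, Real.volume_Ico]; congr 1; ring
  have e2 : ENNReal.ofReal ((b - a) / 2) * 2 = ENNReal.ofReal (b - a) := by
    rw [← ENNReal.ofReal_ofNat, ← ENNReal.ofReal_mul (by linarith)]; congr 1; ring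
  unfold normalizedMass
  rw [el, er, ← ENNReal.add_div, div_eq_mul_inv, div_eq_mul_inv, div_eq_mul_inv, mul_assoc,
    ← ENNReal.mul_inv (by simp) (by simp), e2, tsum_list_bool, add_mul, e]
  congr 1
  rw [List.append_nil, e, ← div_eq_mul_inv]
  exact ENNReal.mul_div_cancel_right (e ▸ h0) (e ▸ ht)

theorem carlesonConstant_le_one_iff {a b : ℝ} {α : List Bool → ℝ} :
    carlesonConstant a b α ≤ 1 ↔ normalizedMass a b α [] ≤ 1 ∧
      carlesonConstant a ((a + b) / 2) (fun J => α (false :: J)) ≤ 1 ∧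
      carlesonConstant ((a + b) / 2) b (fun J => α (true :: J)) ≤ 1 := by
  simp only [carlesonConstant, iSup_le_iff]
  refine ⟨fun h => ⟨h [], fun J => h (false :: J), fun J => h (true :: J)⟩, ?_⟩
  rintro ⟨h, h0, h1⟩ (_ | ⟨_ | _, J⟩)
  exacts [h, h0 J, h1 J]

theorem average_eq_half {a b : ℝ} (hab : a < b) {f : ℝ → ℝ} (hf : IntegrableOn f (Set.Ico a b)) :
    ⨍ x in Set.Ico a b, f x = ((⨍ x in Set.Ico a ((a + b) / 2), f x) +
      ⨍ x in Set.Ico ((a + b) / 2) b, f x) / 2 := by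
  have hl : a ≤ (a + b) / 2 := by linarith
  have hr : (a + b) / 2 ≤ b := by linarith
  rw [← Set.Ico_union_Ico_eq_Ico hl hr] at hf
  have : ∫ x in Set.Ico a b, f x = (∫ x in Set.Ico a ((a + b) / 2), f x) +
      ∫ x in Set.Ico ((a + b) / 2) b, f x := by
    rw [← setIntegral_union (Set.Ico_disjoint_Ico_same) measurableSet_Ico
      hf.left_of_union hf.right_of_union, Set.Ico_union_Ico_eq_Ico hl hr]
  simp only [setAverage_eq, Real.volume_real_Ico_of_le hab.le, Real.volume_real_Ico_of_le hl,
    Real.volume_real_Ico_of_le hr, this, smul_eq_mul]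
  have h0 : b - a ≠ 0 := by linarith
  have h1 : (a + b) / 2 - a = (b - a) / 2 := by ring
  have h2 : b - (a + b) / 2 = (b - a) / 2 := by ring
  rw [h1, h2]
  field_simp

/-! ### Level sets -/

/-- The level set of the operator over `[a, b)`. -/
def levelSet (a b : ℝ) (α : List Bool → ℝ) (f : ℝ → ℝ) (lam : ℝ) : Set ℝ :=
  {x | x ∈ Set.Ico a b ∧ ENNReal.ofReal lam < lernerOp a b α f x}

theorem volume_levelSet_le (a b : ℝ) (α : List Bool → ℝ) (f : ℝ → ℝ) (lam : ℝ) :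
    volume (levelSet a b α f lam) ≤ ENNReal.ofReal (b - a) :=
  (measure_mono fun _ hx => hx.1).trans Real.volume_Ico.le

/-- The top term of the operator acts as a shift of the level. -/
theorem volume_levelSet_eq {a b : ℝ} (hab : a < b) {α : List Bool → ℝ} {f : ℝ → ℝ} {lam : ℝ}
    (h0 : 0 ≤ α [] * ⨍ y in Set.Ico a b, f y) (h : α [] * (⨍ y in Set.Ico a b, f y) ≤ lam) :
    volume (levelSet a b α f lam) =
      volume (levelSet a ((a + b) / 2) (fun J => α (false :: J)) f
        (lam - α [] * ⨍ y in Set.Ico a b, f y)) +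
      volume (levelSet ((a + b) / 2) b (fun J => α (true :: J)) f
        (lam - α [] * ⨍ y in Set.Ico a b, f y)) := by
  set c := α [] * ⨍ y in Set.Ico a b, f y with hc
  -- This needs c ≤ lam: `ENNReal.ofReal` would truncate a negative level lam - c to 0.
  have key (y : ℝ≥0∞) : ENNReal.ofReal lam < ENNReal.ofReal c + y ↔
      ENNReal.ofReal (lam - c) < y := by
    rw [← ENNReal.add_lt_add_iff_left (b := ENNReal.ofReal (lam - c))
      (ENNReal.ofReal_ne_top (r := c)), ← ENNReal.ofReal_add h0 (by linarith), add_sub_cancel]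
  -- Only the left half has to be measurable for this splitting; measurability of the level set
  -- plays no role.
  rw [← measure_inter_add_sdiff (levelSet a b α f lam)
    (measurableSet_Ico (a := a) (b := (a + b) / 2))]
  congr 2
  · ext x
    simp only [levelSet, Set.mem_inter_iff, Set.mem_ofPred_eq]
    constructor
    · rintro ⟨⟨-, h2⟩, h3⟩
      rw [lernerOp_left hab h3, ← hc, key] at h2
      exact ⟨h3, h2⟩
    · rintro ⟨h3, h2⟩
      rw [← key, hc, ← lernerOp_left hab h3] at h2
      exact ⟨⟨⟨h3.1, by linarith [h3.2]⟩, h2⟩, h3⟩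
  · ext x
    simp only [levelSet, Set.mem_sdiff, Set.mem_ofPred_eq]
    constructor
    · rintro ⟨⟨h1, h2⟩, h3⟩
      have h3 : x ∈ Set.Ico ((a + b) / 2) b :=
        ⟨not_lt.1 fun h => h3 ⟨h1.1, h⟩, h1.2⟩
      rw [lernerOp_right hab h3, ← hc, key] at h2
      exact ⟨h3, h2⟩
    · rintro ⟨h3, h2⟩
      rw [← key, hc, ← lernerOp_right hab h3] at h2
      exact ⟨⟨⟨by linarith [h3.1], h3.2⟩, h2⟩, fun h => by linarith [h.2, h3.1]⟩

/-! ### Concavity of the mixed mean -/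

/-- The harmonic mean of `x` and `A` below the diagonal `x = A`, the geometric mean above it. -/
noncomputable def mixedMean (x A : ℝ) : ℝ :=
  if x ≤ A then 2 * A * x / (A + x) else √(A * x)

theorem mixedMean_le_sqrt {x A : ℝ} (hx : 0 ≤ x) (hA : 0 ≤ A) : mixedMean x A ≤ √(A * x) := by
  unfold mixedMean
  split_ifs with h
  · rcases hx.eq_or_lt with rfl | hx'
    · simp
    apply Real.le_sqrt_of_sq_le
    rw [div_pow, div_le_iff₀ (by positivity)]
    nlinarith [mul_nonneg (mul_nonneg hA hx) (sq_nonneg (A - x))]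
  · rfl

theorem mixedMean_of_ge {x A : ℝ} (hA : 0 ≤ A) (h : A ≤ x) : mixedMean x A = √(A * x) := by
  rcases h.eq_or_lt with rfl | h'
  · rw [mixedMean, if_pos le_rfl, Real.sqrt_mul_self hA]
    rcases hA.eq_or_lt with rfl | hA
    · simp
    field_simp
    norm_num
  · rw [mixedMean, if_neg h'.not_ge]

/-- The inequality of arithmetic and geometric means for y / x and B / A; the right side is the
tangent plane of the geometric mean at (x, A). -/
theorem sqrt_mul_le_add {x A y B : ℝ} (hx : 0 < x) (hA : 0 < A) (hy : 0 ≤ y) (hB : 0 ≤ B) :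
    √(B * y) ≤ √(A * x) * ((y / x + B / A) / 2) := by
  rw [Real.sqrt_le_left (by positivity), mul_pow, Real.sq_sqrt (by positivity)]
  have : A * x * ((y / x + B / A) / 2) ^ 2 = (A * y + B * x) ^ 2 / (4 * (A * x)) := by
    field_simp
    norm_num
  rw [this, le_div_iff₀ (by positivity)]
  nlinarith [sq_nonneg (A * y - B * x)]

/-- The tangent plane of `mixedMean` at a point lies above its graph. -/
theorem mixedMean_le_tangent {x A : ℝ} (hx : 0 < x) (hA : 0 < A) :
    ∃ p q : ℝ, p * x + q * A = mixedMean x A ∧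
      ∀ y B, 0 ≤ y → 0 ≤ B → mixedMean y B ≤ p * y + q * B := by
  by_cases h : x ≤ A
  -- The gradient of the harmonic mean at (x, A). By homogeneity of degree one, the tangent plane
  -- passes through the origin.
  · refine ⟨2 * A ^ 2 / (A + x) ^ 2, 2 * x ^ 2 / (A + x) ^ 2, ?_, fun y B hy hB => ?_⟩
    · rw [mixedMean, if_pos h]
      field_simp
    · have e : 2 * A ^ 2 / (A + x) ^ 2 * y + 2 * x ^ 2 / (A + x) ^ 2 * B =
          2 * (A ^ 2 * y + x ^ 2 * B) / (A + x) ^ 2 := by ring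
      rw [e]
      by_cases h' : y ≤ B
      · rw [mixedMean, if_pos h']
        rcases hB.eq_or_lt with rfl | hB'
        · simp; positivity
        rw [div_le_div_iff₀ (by positivity) (by positivity)]
        nlinarith [sq_nonneg (A * y - x * B)]
      · rw [mixedMean, if_neg h']
        -- Across the diagonal the arithmetic mean fits in between: Chebyshev's sum inequality, from
        -- x ≤ A and B ≤ y, gives (A ^ 2 + x ^ 2) * (B + y) ≤ 2 * (A ^ 2 * y + x ^ 2 * B), and (A +
        -- x) ^ 2 ≤ 2 * (A ^ 2 + x ^ 2).
        have h1 : √(B * y) ≤ (B + y) / 2 := by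
          rw [Real.sqrt_le_left (by positivity)]
          nlinarith [sq_nonneg (B - y)]
        refine h1.trans ?_
        rw [le_div_iff₀ (by positivity)]
        have hA2 : x ^ 2 ≤ A ^ 2 := by nlinarith
        nlinarith [mul_nonneg (sub_nonneg.2 hA2) (sub_nonneg.2 (not_le.1 h').le),
          mul_nonneg (add_nonneg hB hy) (sq_nonneg (A - x))]
  · have h := not_le.1 h
    refine ⟨√(A * x) / (2 * x), √(A * x) / (2 * A), ?_, fun y B hy hB => ?_⟩
    · rw [mixedMean_of_ge hA.le h.le]
      field_simp
      norm_num
    · refine (mixedMean_le_sqrt hy hB).trans ((sqrt_mul_le_add hx hA hy hB).trans_eq ?_)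
      field_simp

theorem mixedMean_nonneg {x A : ℝ} (hx : 0 ≤ x) (hA : 0 ≤ A) : 0 ≤ mixedMean x A := by
  unfold mixedMean
  split_ifs <;> positivity

/-- Both points lie below the tangent plane at their midpoint. That plane is available only in the
open quadrant; on the axes every term vanishes. -/
theorem mixedMean_midpoint {x y A B : ℝ} (hx : 0 ≤ x) (hy : 0 ≤ y) (hA : 0 ≤ A) (hB : 0 ≤ B) :
    (mixedMean x A + mixedMean y B) / 2 ≤ mixedMean ((x + y) / 2) ((A + B) / 2) := by
  rcases (show 0 ≤ (x + y) / 2 by positivity).eq_or_lt with h | h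
  · obtain rfl : x = 0 := by linarith
    obtain rfl : y = 0 := by linarith
    have (C : ℝ) : mixedMean 0 C = 0 := by simp [mixedMean]
    simp [this]
  rcases (show 0 ≤ (A + B) / 2 by positivity).eq_or_lt with h' | h'
  · obtain rfl : A = 0 := by linarith
    obtain rfl : B = 0 := by linarith
    have (z : ℝ) : mixedMean z 0 = 0 := by simp [mixedMean]
    simp [this]
  obtain ⟨p, q, e, hpq⟩ := mixedMean_le_tangent h h'
  rw [← e]
  linarith [hpq x A hx hA, hpq y B hy hB]

/-! ### The Bellman function and its jump inequality -/

/-- The Bellman function of the weak-type problem, for `0 ≤ t`, `0 ≤ A ≤ 1` and `0 < lam`. -/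
noncomputable def bellman (t A lam : ℝ) : ℝ := min 1 (mixedMean (t / lam) A)

theorem bellman_nonneg {t A lam : ℝ} (ht : 0 ≤ t) (hA : 0 ≤ A) (hl : 0 ≤ lam) :
    0 ≤ bellman t A lam :=
  le_min zero_le_one (mixedMean_nonneg (by positivity) hA)

theorem bellman_midpoint {s t A B lam : ℝ} (hs : 0 ≤ s) (ht : 0 ≤ t) (hA : 0 ≤ A) (hB : 0 ≤ B)
    (hl : 0 < lam) :
    (bellman s A lam + bellman t B lam) / 2 ≤ bellman ((s + t) / 2) ((A + B) / 2) lam := by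
  have h := mixedMean_midpoint (x := s / lam) (y := t / lam) (by positivity) (by positivity) hA hB
  rw [← add_div, div_right_comm] at h
  have h1 (u B : ℝ) : bellman u B lam ≤ 1 := min_le_left _ _
  have h2 (u B : ℝ) : bellman u B lam ≤ mixedMean (u / lam) B := min_le_right _ _
  refine le_min ?_ (le_trans ?_ h)
  · linarith [h1 s A, h1 t B]
  · linarith [h2 s A, h2 t B]

theorem bellman_eq_one {t A lam : ℝ} (hA0 : 0 ≤ A) (hA : A ≤ 1) (hl : 0 < lam)
    (h : lam ≤ A * t) : bellman t A lam = 1 := by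
  have hAt : 1 ≤ A * (t / lam) := by
    rw [← mul_div_assoc, one_le_div hl]; exact h
  have hx : A ≤ t / lam := by
    by_contra! hx
    obtain rfl : A = 1 := le_antisymm hA (by nlinarith)
    linarith
  rw [bellman, mixedMean_of_ge hA0 hx, min_eq_left]
  exact Real.one_le_sqrt.2 hAt

/-- A jump that starts in the geometric region. After cross-multiplication the claim for geometric
means is implied by A * t ≤ lam; where the jump ends is irrelevant, because the geometric mean
dominates `mixedMean` everywhere. -/
theorem mixedMean_jump_of_ge {t A lam c : ℝ} (ht : 0 ≤ t) (hc : 0 ≤ c) (hcA : c ≤ A)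
    (hl : 0 < lam - c * t) (h : A * t ≤ lam) (hreg : A ≤ t / lam) :
    mixedMean (t / (lam - c * t)) (A - c) ≤ mixedMean (t / lam) A := by
  have hl' : 0 < lam := by nlinarith
  rw [mixedMean_of_ge (hc.trans hcA) hreg]
  refine (mixedMean_le_sqrt (by positivity) (by linarith)).trans (Real.sqrt_le_sqrt ?_)
  rw [← mul_div_assoc, ← mul_div_assoc, div_le_div_iff₀ hl hl']
  nlinarith [mul_nonneg (mul_nonneg hc ht) (sub_nonneg.2 h)]

/-- A jump that ends in the harmonic region also starts there. Cross-multiplication reduces the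
claim to c * t ^ 2 * (1 - A * (A - c)) ≥ 0, which is where the Carleson bound A ≤ 1 enters. -/
theorem mixedMean_jump_of_le {t A lam c : ℝ} (ht : 0 ≤ t) (hc : 0 ≤ c) (hcA : c ≤ A) (hA : A ≤ 1)
    (hl : 0 < lam - c * t) (hreg : t / (lam - c * t) ≤ A - c) :
    mixedMean (t / (lam - c * t)) (A - c) ≤ mixedMean (t / lam) A := by
  have hl' : 0 < lam := by nlinarith
  have hle : t / lam ≤ A := by
    refine le_trans ?_ (hreg.trans (by linarith))
    exact div_le_div_of_nonneg_left ht hl (by nlinarith)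
  rw [mixedMean, mixedMean, if_pos hreg, if_pos hle]
  rcases ht.eq_or_lt with rfl | ht'
  · simp
  have hA0 : 0 ≤ A - c := by linarith
  have e (B l : ℝ) (hl : 0 < l) (hB : 0 ≤ B) :
      2 * B * (t / l) / (B + t / l) = 2 * B * t / (B * l + t) := by
    field_simp
  rw [e _ _ hl hA0, e _ _ hl' (by linarith), div_le_div_iff₀ (by positivity)
    (by have := hA0.trans (sub_le_self A hc); positivity)]
  have h1 : A * (A - c) ≤ 1 := by nlinarith
  have h2 : 0 ≤ c * t ^ 2 * (1 - A * (A - c)) := by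
    have := sub_nonneg.2 h1
    positivity
  nlinarith

/-- Spending `c` of the mass at the top lowers the level by `c * t` and does not increase the
Bellman function. -/
theorem bellman_jump {t A lam c : ℝ} (ht : 0 ≤ t) (hc : 0 ≤ c) (hcA : c ≤ A) (hA : A ≤ 1)
    (hl : 0 < lam - c * t) : bellman t (A - c) (lam - c * t) ≤ bellman t A lam := by
  have hl' : 0 < lam := by nlinarith
  rcases le_total lam (A * t) with h | h
  · rw [bellman_eq_one (hc.trans hcA) hA hl' h]
    exact min_le_left _ _
  refine min_le_min_left 1 ?_
  rcases le_total (t / (lam - c * t)) (A - c) with h1 | h1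
  · exact mixedMean_jump_of_le ht hc hcA hA hl h1
  rcases le_total A (t / lam) with h2 | h2
  · exact mixedMean_jump_of_ge ht hc hcA hl h h2
  rw [div_le_iff₀ hl'] at h2
  rw [le_div_iff₀ hl] at h1
  -- The jump starts in the harmonic region and ends in the geometric one. It is cut at a point d
  -- where it meets the diagonal, and each piece falls under one of the two lemmas.
  obtain ⟨d, ⟨hd0, hdc⟩, hd⟩ := intermediate_value_Icc' (f := fun d => (A - d) * (lam - d * t))
    (a := 0) (b := c) hc (by fun_prop) (show t ∈ _ from ⟨h1, by simpa using h2⟩)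
  simp only at hd
  have hld : 0 < lam - d * t := by nlinarith
  have hreg : t / (lam - d * t) = A - d := by rw [div_eq_iff hld.ne', hd]
  have := mixedMean_jump_of_ge (t := t) (A := A - d) (lam := lam - d * t) (c := c - d) ht
    (by linarith) (by linarith) (by linarith) (by linarith) hreg.ge
  rw [show lam - d * t - (c - d) * t = lam - c * t by ring,
    show A - d - (c - d) = A - c by ring] at this
  exact this.trans (mixedMean_jump_of_le ht hd0 (hdc.trans hcA) hA hld hreg.le)

theorem bellman_eq {t A lam : ℝ} (ht : 0 < t) (hA : 0 < A) (hA1 : A ≤ 1) (hl : 0 < lam) :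
    bellman t A lam = if t ≤ A * lam ∧ A * lam ≤ lam then 2 * A * t / (A * lam + t)
      else if A ≤ min (t / lam) (lam / t) then √(A * t / lam) else 1 := by
  have hAl : A * lam ≤ lam := by nlinarith
  split_ifs with h1 h2
  · have h := (div_le_iff₀ hl).2 h1.1
    have e : 2 * A * (t / lam) / (A + t / lam) = 2 * A * t / (A * lam + t) := by
      field_simp
    rw [bellman, mixedMean, if_pos h, e, min_eq_right]
    rw [div_le_one (by positivity)]
    nlinarith [h1.1]
  · obtain ⟨h2, h3⟩ := le_min_iff.1 h2
    rw [le_div_iff₀ ht] at h3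
    rw [bellman, mixedMean_of_ge hA.le h2, ← mul_div_assoc, min_eq_right]
    rw [Real.sqrt_le_one, div_le_one hl]
    exact h3
  · refine bellman_eq_one hA.le hA1 hl ?_
    have h3 : A < t / lam := by
      rw [lt_div_iff₀ hl]; exact not_le.1 fun h => h1 ⟨h, hAl⟩
    by_contra! h4
    exact h2 (le_min h3.le ((le_div_iff₀ ht).2 h4.le))

/-! ### Upper bound by truncation -/

/-- The sequence `α` cut off to addresses of length less than `n`. -/
def truncate (n : ℕ) (α : List Bool → ℝ) (J : List Bool) : ℝ := if J.length < n then α J else 0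

theorem truncate_succ_cons (n : ℕ) (α : List Bool → ℝ) (c : Bool) :
    (fun J => truncate (n + 1) α (c :: J)) = truncate n (fun J => α (c :: J)) := by
  funext J
  simp [truncate]

theorem monotone_truncate {α : List Bool → ℝ} (hα : ∀ J, 0 ≤ α J) (J : List Bool) :
    Monotone fun n => truncate n α J := by
  intro m n hmn
  simp only [truncate]
  split_ifs with h1 h2 h2
  · exact le_rfl
  · omega
  · exact hα J
  · exact le_rfl

theorem average_nonneg {a b : ℝ} {f : ℝ → ℝ} (hf : ∀ x ∈ Set.Ico a b, 0 ≤ f x) :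
    0 ≤ ⨍ x in Set.Ico a b, f x := by
  rw [setAverage_eq]
  exact smul_nonneg (by positivity) (setIntegral_nonneg measurableSet_Ico hf)

theorem lernerOp_mono {a b x : ℝ} (hab : a < b) {α β : List Bool → ℝ} {f : ℝ → ℝ}
    (hf : ∀ x ∈ Set.Ico a b, 0 ≤ f x) (h : ∀ J, α J ≤ β J) :
    lernerOp a b α f x ≤ lernerOp a b β f x := by
  refine ENNReal.tsum_le_tsum fun J => Set.indicator_le_indicator ?_
  refine ENNReal.ofReal_le_ofReal (mul_le_mul_of_nonneg_right (h J) ?_)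
  exact average_nonneg fun x hx => hf x (dyadicInterval_subset hab J hx)

theorem exists_lt_lernerOp_truncate {a b x : ℝ} {α : List Bool → ℝ} {f : ℝ → ℝ} {y : ℝ≥0∞}
    (h : y < lernerOp a b α f x) : ∃ n, y < lernerOp a b (truncate n α) f x := by
  rw [lernerOp, ENNReal.tsum_eq_iSup_sum, lt_iSup_iff] at h
  obtain ⟨s, hs⟩ := h
  refine ⟨s.sup List.length + 1, hs.trans_le ((Finset.sum_le_sum fun J hJ => ?_).trans
    (ENNReal.sum_le_tsum s))⟩
  have : J.length < s.sup List.length + 1 := Nat.lt_succ_of_le (Finset.le_sup hJ)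
  simp [truncate, this]

/-- The bound keeps the mass of the full sequence α, so the induction uses its exact recursion and
its Carleson condition; only the operator is truncated. -/
theorem volume_levelSet_truncate_le (n : ℕ) {a b : ℝ} (hab : a < b) {f : ℝ → ℝ}
    {α : List Bool → ℝ} (hf : ∀ x ∈ Set.Ico a b, 0 ≤ f x) (hfi : IntegrableOn f (Set.Ico a b))
    (hα : ∀ J, 0 ≤ α J) (hc : carlesonConstant a b α ≤ 1) {lam : ℝ} (hl : 0 < lam) :
    volume (levelSet a b (truncate n α) f lam) ≤ ENNReal.ofReal
      ((b - a) * bellman (⨍ x in Set.Ico a b, f x) (normalizedMass a b α []).toReal lam) := by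
  induction n generalizing a b α lam with
  | zero =>
    have : levelSet a b (truncate 0 α) f lam = ∅ := by
      ext x
      simp [levelSet, truncate, lernerOp]
    simp [this]
  | succ n ih =>
    have hl1 : a < (a + b) / 2 := by linarith
    have hr1 : (a + b) / 2 < b := by linarith
    have hls : Set.Ico a ((a + b) / 2) ⊆ Set.Ico a b := Set.Ico_subset_Ico_right hr1.le
    have hrs : Set.Ico ((a + b) / 2) b ⊆ Set.Ico a b := Set.Ico_subset_Ico_left hl1.le
    obtain ⟨h1, hcl, hcr⟩ := carlesonConstant_le_one_iff.1 hc
    have h1l := (carlesonConstant_le_one_iff.1 hcl).1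
    have h1r := (carlesonConstant_le_one_iff.1 hcr).1
    have hM : (normalizedMass a b α []).toReal = α [] +
        ((normalizedMass a ((a + b) / 2) (fun J => α (false :: J)) []).toReal +
          (normalizedMass ((a + b) / 2) b (fun J => α (true :: J)) []).toReal) / 2 := by
      have tl := (h1l.trans_lt ENNReal.one_lt_top).ne
      have tr := (h1r.trans_lt ENNReal.one_lt_top).ne
      rw [normalizedMass_nil hab, ENNReal.toReal_add ENNReal.ofReal_ne_top
        (ENNReal.div_ne_top (ENNReal.add_ne_top.2 ⟨tl, tr⟩) two_ne_zero),
        ENNReal.toReal_ofReal (hα []), ENNReal.toReal_div, ENNReal.toReal_add tl tr]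
      simp
    have hM1 : (normalizedMass a b α []).toReal ≤ 1 := ENNReal.toReal_le_of_le_ofReal zero_le_one
      (by simpa using h1)
    have ht := average_eq_half hab hfi
    have ht0 := average_nonneg hf
    have htl := average_nonneg fun x hx => hf x (hls hx)
    have htr := average_nonneg fun x hx => hf x (hrs hx)
    have hMl : 0 ≤ (normalizedMass a ((a + b) / 2) (fun J => α (false :: J)) []).toReal :=
      ENNReal.toReal_nonneg
    have hMr : 0 ≤ (normalizedMass ((a + b) / 2) b (fun J => α (true :: J)) []).toReal :=
      ENNReal.toReal_nonneg
    have htop : truncate (n + 1) α [] = α [] := by simp [truncate]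
    have hα0 := hα []
    -- If the top term alone reaches the level, then lam is at most mass times average, the Bellman
    -- function is 1 and the bound is trivial. Otherwise the level stays positive after the shift.
    rcases le_or_gt lam (α [] * ⨍ x in Set.Ico a b, f x) with h | h
    · rw [bellman_eq_one ENNReal.toReal_nonneg hM1 hl, mul_one]
      · exact volume_levelSet_le _ _ _ _ _
      · exact h.trans (mul_le_mul_of_nonneg_right (by linarith) ht0)
    · have hl' := sub_pos.2 h
      rw [volume_levelSet_eq hab (by rw [htop]; positivity) (by rw [htop]; exact h.le), htop,
        truncate_succ_cons, truncate_succ_cons]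
      refine (add_le_add
        (ih hl1 (fun x hx => hf x (hls hx)) (hfi.mono_set hls) (fun J => hα _) hcl hl')
        (ih hr1 (fun x hx => hf x (hrs hx)) (hfi.mono_set hrs) (fun J => hα _) hcr hl')).trans ?_
      rw [← ENNReal.ofReal_add (mul_nonneg (by linarith) (bellman_nonneg htl hMl hl'.le))
        (mul_nonneg (by linarith) (bellman_nonneg htr hMr hl'.le))]
      refine ENNReal.ofReal_le_ofReal ?_
      have hmid := bellman_midpoint htl htr hMl hMr hl'
      rw [← ht] at hmid
      have hjump := bellman_jump ht0 hα0 (by rw [hM]; linarith) hM1 hl'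
      rw [hM, add_sub_cancel_left, ← hM] at hjump
      have := mul_le_mul_of_nonneg_left (hmid.trans hjump) (sub_nonneg.2 hab.le)
      linarith

theorem volume_levelSet_le_bellman {a b t A lam : ℝ} (hab : a < b) {f : ℝ → ℝ}
    {α : List Bool → ℝ} (h : Admissible a b t A f α) (hA : 0 ≤ A) (hl : 0 < lam) :
    volume (levelSet a b α f lam) ≤ ENNReal.ofReal ((b - a) * bellman t A lam) := by
  obtain ⟨hf, hfi, ht, hα, hc, hm⟩ := h
  have hmono : Monotone fun n => levelSet a b (truncate n α) f lam := fun m n hmn x hx =>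
    ⟨hx.1, hx.2.trans_le (lernerOp_mono hab hf fun J => monotone_truncate hα J hmn)⟩
  have hsub : levelSet a b α f lam ⊆ ⋃ n, levelSet a b (truncate n α) f lam := fun x hx => by
    obtain ⟨n, hn⟩ := exists_lt_lernerOp_truncate hx.2
    exact Set.mem_iUnion.2 ⟨n, hx.1, hn⟩
  refine (measure_mono hsub).trans ?_
  rw [hmono.measure_iUnion]
  refine iSup_le fun n => (volume_levelSet_truncate_le n hab hf hfi hα hc hl).trans_eq ?_
  rw [ht, hm, ENNReal.toReal_ofReal hA]

/-! ### Lower bound: operations on attainable data -/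

/-- On every interval, the data `t`, `A` and the level `lam` admit a pair whose level set fills at
least the proportion `r`. -/
def Attained (t A lam r : ℝ) : Prop :=
  ∀ a b : ℝ, a < b → ∃ (f : ℝ → ℝ) (α : List Bool → ℝ), Admissible a b t A f α ∧
    ENNReal.ofReal (r * (b - a)) ≤ volume (levelSet a b α f lam)

/-- The function equal to `f` to the left of `m` and to `g` from `m` on. -/
noncomputable def glueFun (m : ℝ) (f g : ℝ → ℝ) (x : ℝ) : ℝ := if x < m then f x else g x

/-- The sequence with value `s` at the top and given restrictions to the two halves. -/
def glueSeq (s : ℝ) (α β : List Bool → ℝ) : List Bool → ℝ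
  | [] => s
  | false :: J => α J
  | true :: J => β J

theorem Admissible.average_nonneg {a b t A : ℝ} {f : ℝ → ℝ} {α : List Bool → ℝ}
    (h : Admissible a b t A f α) : 0 ≤ t := by
  rw [← h.2.2.1]
  exact LernerOperator.average_nonneg h.1

theorem Attained.nonneg {t A lam r : ℝ} (h : Attained t A lam r) : 0 ≤ t :=
  let ⟨_, _, h, _⟩ := h 0 1 one_pos
  h.average_nonneg

theorem Attained.mono {t A lam r s : ℝ} (h : Attained t A lam r) (hs : s ≤ r) :
    Attained t A lam s := fun a b hab =>
  let ⟨f, α, had, hv⟩ := h a b hab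
  ⟨f, α, had, (ENNReal.ofReal_le_ofReal
    (mul_le_mul_of_nonneg_right hs (sub_nonneg.2 hab.le))).trans hv⟩

theorem Admissible.glue {a b t A u B : ℝ} (hab : a < b) {f g : ℝ → ℝ} {α β : List Bool → ℝ}
    (hA : 0 ≤ A) (hB : 0 ≤ B)
    (hl : Admissible a ((a + b) / 2) t A f α) (hr : Admissible ((a + b) / 2) b u B g β) :
    Admissible a b ((t + u) / 2) ((A + B) / 2) (glueFun ((a + b) / 2) f g) (glueSeq 0 α β) := by
  have el : Set.EqOn (glueFun ((a + b) / 2) f g) f (Set.Ico a ((a + b) / 2)) :=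
    fun x hx => if_pos hx.2
  have er : Set.EqOn (glueFun ((a + b) / 2) f g) g (Set.Ico ((a + b) / 2) b) :=
    fun x hx => if_neg hx.1.not_gt
  have hU : Set.Ico a ((a + b) / 2) ∪ Set.Ico ((a + b) / 2) b = Set.Ico a b :=
    Set.Ico_union_Ico_eq_Ico (by linarith) (by linarith)
  obtain ⟨hf, hfi, hft, hα, hαc, hαA⟩ := hl
  obtain ⟨hg, hgi, hgt, hβ, hβc, hβB⟩ := hr
  have hint : IntegrableOn (glueFun ((a + b) / 2) f g) (Set.Ico a b) := by
    rw [← hU]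
    exact (hfi.congr_fun el.symm measurableSet_Ico).union
      (hgi.congr_fun er.symm measurableSet_Ico)
  have hmass : normalizedMass a b (glueSeq 0 α β) [] = ENNReal.ofReal ((A + B) / 2) := by
    rw [normalizedMass_nil hab]
    change ENNReal.ofReal 0 + (normalizedMass a ((a + b) / 2) α [] +
      normalizedMass ((a + b) / 2) b β []) / 2 = _
    rw [hαA, hβB, ← ENNReal.ofReal_add hA hB, ENNReal.ofReal_zero, zero_add,
      ENNReal.ofReal_div_of_pos two_pos, ENNReal.ofReal_ofNat]
  refine ⟨fun x hx => ?_, hint, ?_, ?_, ?_, hmass⟩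
  · rw [← hU] at hx
    rcases hx with hx | hx
    · rw [el hx]; exact hf x hx
    · rw [er hx]; exact hg x hx
  · rw [average_eq_half hab hint, ← hft, ← hgt]
    simp only [setAverage_eq, setIntegral_congr_fun measurableSet_Ico el,
      setIntegral_congr_fun measurableSet_Ico er]
  · rintro (_ | ⟨_ | _, J⟩)
    exacts [le_rfl, hα J, hβ J]
  · refine carlesonConstant_le_one_iff.2 ⟨?_, hαc, hβc⟩
    rw [hmass]
    have h1 := (carlesonConstant_le_one_iff.1 hαc).1
    have h2 := (carlesonConstant_le_one_iff.1 hβc).1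
    rw [hαA, ENNReal.ofReal_le_one] at h1
    rw [hβB, ENNReal.ofReal_le_one] at h2
    rw [ENNReal.ofReal_le_one]
    linarith

theorem levelSet_congr {a b : ℝ} (hab : a < b) (α : List Bool → ℝ) {f g : ℝ → ℝ}
    (h : Set.EqOn f g (Set.Ico a b)) (lam : ℝ) : levelSet a b α f lam = levelSet a b α g lam := by
  rw [levelSet, lernerOp_congr hab α h, levelSet]

theorem Attained.midpoint {t A u B lam r s : ℝ} (hA : 0 ≤ A) (hB : 0 ≤ B) (hl : 0 ≤ lam)
    (hr0 : 0 ≤ r) (hs0 : 0 ≤ s)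
    (h1 : Attained t A lam r) (h2 : Attained u B lam s) :
    Attained ((t + u) / 2) ((A + B) / 2) lam ((r + s) / 2) := by
  intro a b hab
  have hm1 : a < (a + b) / 2 := by linarith
  have hm2 : (a + b) / 2 < b := by linarith
  obtain ⟨f, α, hf, hfv⟩ := h1 a ((a + b) / 2) hm1
  obtain ⟨g, β, hg, hgv⟩ := h2 ((a + b) / 2) b hm2
  refine ⟨_, _, hf.glue hab hA hB hg, ?_⟩
  rw [volume_levelSet_eq hab (by simp [glueSeq]) (by simpa [glueSeq] using hl)]
  have el : Set.EqOn (glueFun ((a + b) / 2) f g) f (Set.Ico a ((a + b) / 2)) :=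
    fun x hx => if_pos hx.2
  have er : Set.EqOn (glueFun ((a + b) / 2) f g) g (Set.Ico ((a + b) / 2) b) :=
    fun x hx => if_neg hx.1.not_gt
  rw [levelSet_congr hm1 _ el, levelSet_congr hm2 _ er]
  simp only [glueSeq, zero_mul, sub_zero]
  refine le_trans (le_of_eq ?_) (add_le_add hfv hgv)
  rw [← ENNReal.ofReal_add (mul_nonneg hr0 (by linarith)) (mul_nonneg hs0 (by linarith))]
  congr 1
  ring

/-- Adding `s` to the coefficient at the top raises the level by `s * t`. -/
theorem Attained.jump {t A lam r s : ℝ} (hA : 0 ≤ A) (hs : 0 ≤ s) (hAs : A + s ≤ 1)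
    (hl : 0 ≤ lam) (h : Attained t A lam r) : Attained t (A + s) (lam + s * t) r := by
  intro a b hab
  obtain ⟨f, α, had, hv⟩ := h a b hab
  have ht := had.average_nonneg
  obtain ⟨hf, hfi, hft, hα, hαc, hαA⟩ := had
  set α' := glueSeq (α [] + s) (fun J => α (false :: J)) (fun J => α (true :: J))
  have hmass : normalizedMass a b α' [] = ENNReal.ofReal (A + s) := by
    rw [normalizedMass_nil hab] at hαA ⊢
    change ENNReal.ofReal (α [] + s) + (normalizedMass a ((a + b) / 2) (fun J => α (false :: J)) []
      + normalizedMass ((a + b) / 2) b (fun J => α (true :: J)) []) / 2 = _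
    rw [ENNReal.ofReal_add (hα []) hs, add_right_comm, hαA, ENNReal.ofReal_add hA hs]
  refine ⟨f, α', ⟨hf, hfi, hft, ?_, ?_, hmass⟩, hv.trans (measure_mono fun x hx => ⟨hx.1, ?_⟩)⟩
  · rintro (_ | ⟨_ | _, J⟩)
    exacts [add_nonneg (hα []) hs, hα _, hα _]
  · obtain ⟨-, h2, h3⟩ := carlesonConstant_le_one_iff.1 hαc
    refine carlesonConstant_le_one_iff.2 ⟨?_, h2, h3⟩
    rw [hmass, ENNReal.ofReal_le_one]
    exact hAs
  · have hx2 := hx.2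
    have h0 := hα []
    rw [lernerOp_eq hx.1, hft] at hx2 ⊢
    change _ < ENNReal.ofReal ((α [] + s) * t) +
      (lernerOp a ((a + b) / 2) (fun J => α (false :: J)) f x +
        lernerOp ((a + b) / 2) b (fun J => α (true :: J)) f x)
    rw [add_mul, ENNReal.ofReal_add hl (by positivity),
      ENNReal.ofReal_add (p := α [] * t) (by positivity) (by positivity), add_right_comm]
    exact ENNReal.add_lt_add_right ENNReal.ofReal_ne_top hx2

theorem admissible_const {a b t A : ℝ} (hab : a < b) (ht : 0 ≤ t) (hA : 0 ≤ A) (hA1 : A ≤ 1) :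
    Admissible a b t A (fun _ => t) (glueSeq A 0 0) := by
  have hm (c d : ℝ) (J : List Bool) : normalizedMass c d 0 J = 0 := by
    simp [normalizedMass]
  have hmass : normalizedMass a b (glueSeq A 0 0) [] = ENNReal.ofReal A := by
    rw [normalizedMass_nil hab]
    change ENNReal.ofReal A + (normalizedMass a ((a + b) / 2) 0 [] +
      normalizedMass ((a + b) / 2) b 0 []) / 2 = _
    simp [hm]
  refine ⟨fun _ _ => ht, integrableOn_const (by simp), ?_, ?_, ?_, hmass⟩
  · exact setAverage_const (by simpa using hab) (by simp) t
  · rintro (_ | ⟨_ | _, J⟩)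
    exacts [hA, le_rfl, le_rfl]
  · refine carlesonConstant_le_one_iff.2 ⟨?_, ?_, ?_⟩
    · rwa [hmass, ENNReal.ofReal_le_one]
    · exact iSup_le fun J => (hm _ _ J).trans_le zero_le_one
    · exact iSup_le fun J => (hm _ _ J).trans_le zero_le_one

theorem attained_zero {t A lam : ℝ} (ht : 0 ≤ t) (hA : 0 ≤ A) (hA1 : A ≤ 1) :
    Attained t A lam 0 := fun _ _ hab =>
  ⟨_, _, admissible_const hab ht hA hA1, by simp⟩

theorem attained_one {t A lam : ℝ} (ht : 0 ≤ t) (hA : 0 ≤ A) (hA1 : A ≤ 1) (hl : 0 ≤ lam)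
    (h : lam < A * t) : Attained t A lam 1 := by
  intro a b hab
  have had := admissible_const hab ht hA hA1
  refine ⟨_, _, had, ?_⟩
  rw [one_mul, ← Real.volume_Ico]
  refine measure_mono fun x hx => ⟨hx, ?_⟩
  rw [lernerOp_eq hx, had.2.2.1]
  refine lt_of_lt_of_le ?_ le_self_add
  exact (ENNReal.ofReal_lt_ofReal_iff (hl.trans_lt h)).2 h

/-- Convex combinations with dyadic weights, by repeated midpoints: one half carries pure data, (u,
B) or (t, A) according to whether k ≤ 2 ^ n, and the other half a combination of lower order. -/
theorem Attained.dyadic {t A u B lam r s : ℝ} (hA : 0 ≤ A) (hB : 0 ≤ B) (hl : 0 ≤ lam)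
    (hr0 : 0 ≤ r) (hs0 : 0 ≤ s) (h1 : Attained t A lam r) (h2 : Attained u B lam s) (n k : ℕ)
    (hk : k ≤ 2 ^ n) :
    Attained (u + k / 2 ^ n * (t - u)) (B + k / 2 ^ n * (A - B)) lam
      (s + k / 2 ^ n * (r - s)) := by
  have pos {x y : ℝ} (hx : 0 ≤ x) (hy : 0 ≤ y) {n k : ℕ} (hk : k ≤ 2 ^ n) :
      0 ≤ y + k / 2 ^ n * (x - y) := by
    have hk' : (k : ℝ) / 2 ^ n ≤ 1 := by
      rw [div_le_one (by positivity)]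
      exact_mod_cast hk
    have : 0 ≤ (k : ℝ) / 2 ^ n := by positivity
    nlinarith
  induction n generalizing k with
  | zero =>
    obtain rfl | rfl : k = 0 ∨ k = 1 := by simp at hk; omega
    · simpa using h2
    · simpa using h1
  | succ n ih =>
    rcases le_or_gt k (2 ^ n) with h | h
    · convert (ih k h).midpoint (pos hA hB h) hB hl (pos hr0 hs0 h) hs0 h2 using 1 <;> ring
    · obtain ⟨j, rfl⟩ := Nat.exists_eq_add_of_le h.le
      have hj : j ≤ 2 ^ n := by rw [pow_succ] at hk; omega
      convert (ih j hj).midpoint (pos hA hB hj) hA hl (pos hr0 hs0 hj) hr0 h1 using 1 <;>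
      · push_cast
        field_simp
        ring

theorem exists_dyadic_between {x y : ℝ} (hx : 0 ≤ x) (hxy : x < y) :
    ∃ n k : ℕ, x < k / 2 ^ n ∧ (k : ℝ) / 2 ^ n < y := by
  obtain ⟨n, hn⟩ := exists_pow_lt_of_lt_one (sub_pos.2 hxy) (show (1 / 2 : ℝ) < 1 by norm_num)
  have h2 : (0 : ℝ) < 2 ^ n := by positivity
  refine ⟨n, ⌊x * 2 ^ n⌋₊ + 1, ?_, ?_⟩
  · rw [lt_div_iff₀ h2]
    exact_mod_cast Nat.lt_floor_add_one (x * 2 ^ n)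
  · rw [div_lt_iff₀ h2]
    have h3 := Nat.floor_le (show 0 ≤ x * 2 ^ n by positivity)
    rw [one_div, inv_pow, inv_lt_iff_one_lt_mul₀ h2] at hn
    push_cast
    linarith

/-- Concentrating the function and the mass on a proportion `θ` of the interval. -/
theorem Attained.scale {t A lam r s θ : ℝ} (hA : 0 ≤ A) (hA1 : A ≤ 1) (hl : 0 ≤ lam)
    (hθ : 0 ≤ θ) (hθ1 : θ ≤ 1) (h : Attained t A lam r) (hs : s < θ * r) :
    Attained (θ * t) (θ * A) lam s := by
  have ht := h.nonneg
  rcases le_or_gt s 0 with hs0 | hs0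
  · exact (attained_zero (by positivity) (by positivity) (by nlinarith)).mono hs0
  have hr : 0 < r := pos_of_mul_pos_right (hs0.trans hs) hθ
  -- The weight θ need not be dyadic. The pair for (t, A) is placed on a dyadic proportion η between
  -- s / r and θ, and the rest carries the fraction (θ - η) / (1 - η) of the data, so that the
  -- totals are exactly θ * t and θ * A.
  obtain ⟨n, k, h1, h2⟩ := exists_dyadic_between (x := s / r) (by positivity)
    ((div_lt_iff₀ hr).2 hs)
  set η : ℝ := k / 2 ^ n with hη
  have hη1 : 0 < 1 - η := by linarith
  have hk : k ≤ 2 ^ n := by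
    have : (k : ℝ) ≤ 2 ^ n := by
      rw [← div_le_one (by positivity)]
      linarith
    exact_mod_cast this
  have hq : 0 ≤ (θ - η) / (1 - η) := div_nonneg (by linarith) hη1.le
  have hq1 : (θ - η) / (1 - η) ≤ 1 := (div_le_one hη1).2 (by linarith)
  have hB : 0 ≤ (θ - η) / (1 - η) * A := by positivity
  have := h.dyadic hA hB hl hr.le le_rfl (attained_zero (t := (θ - η) / (1 - η) * t)
    (by positivity) hB (by nlinarith)) n k hk
  rw [← hη] at this
  have e (x : ℝ) : (θ - η) / (1 - η) * x + η * (x - (θ - η) / (1 - η) * x) = θ * x := by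
    field_simp
    ring
  rw [e, e] at this
  refine this.mono ?_
  rw [div_lt_iff₀ hr] at h1
  linarith

/-- Every proportion below `r` is attained. -/
def Approached (t A lam r : ℝ) : Prop := ∀ s < r, Attained t A lam s

theorem Attained.approached {t A lam r : ℝ} (h : Attained t A lam r) : Approached t A lam r :=
  fun _ hs => h.mono hs.le

theorem Approached.mono {t A lam r s : ℝ} (h : Approached t A lam r) (hs : s ≤ r) :
    Approached t A lam s := fun _ hq => h _ (hq.trans_le hs)

theorem Approached.scale {t A lam r θ : ℝ} (hA : 0 ≤ A) (hA1 : A ≤ 1) (hl : 0 ≤ lam)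
    (hθ : 0 < θ) (hθ1 : θ ≤ 1) (h : Approached t A lam r) :
    Approached (θ * t) (θ * A) lam (θ * r) := by
  intro s hs
  obtain ⟨q, hq1, hq2⟩ := exists_between ((div_lt_iff₀' hθ).2 hs)
  exact (h q hq2).scale hA hA1 hl hθ.le hθ1 ((div_lt_iff₀' hθ).1 hq1)

/-! ### Lower bound: near-extremal constructions -/

/-- At full mass, spend `c` at the top and concentrate the rest on the proportion `1 - c`. -/
theorem Approached.step {t lam r c : ℝ} (hc : 0 ≤ c) (hc1 : c < 1) (hl : 0 ≤ lam - c * t)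
    (h : Approached (t / (1 - c)) 1 (lam - c * t) r) : Approached t 1 lam ((1 - c) * r) := by
  have h1 : 0 < 1 - c := by linarith
  have := h.scale zero_le_one le_rfl hl h1 (by linarith)
  rw [mul_div_cancel₀ _ h1.ne', mul_one] at this
  intro s hs
  have := (this s hs).jump h1.le hc (by linarith) hl
  rwa [sub_add_cancel, sub_add_cancel] at this

/-- Each step multiplies lam / t by at most 1 - c, so n steps bring the level below the average,
where constants attain 1. A step from t ≤ lam leaves the ratio at least (1 - c) ^ 2, which is the
invariant `h'`; the factor 1 + (1 - c) ^ 2 in place of 2 pays for this overshoot. The concentration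
factor 1 - c cancels against the growth of t, and lam + t changes only to second order in c, at the
price of a factor 1 - 2 * c ^ 2 per step. -/
theorem approached_iterate {c : ℝ} (hc : 0 ≤ c) (hc2 : c ≤ 1 / 2) (n : ℕ) {t lam : ℝ} (ht : 0 < t)
    (hl : 0 < lam) (h : lam * (1 - c) ^ n < t) (h' : t * (1 - c) ^ 2 ≤ lam) :
    Approached t 1 lam ((1 - 2 * c ^ 2) ^ n * (1 + (1 - c) ^ 2) * (t / (lam + t))) := by
  have hc3 : 0 ≤ 1 - 2 * c ^ 2 := by nlinarith
  have top (n : ℕ) {t lam : ℝ} (ht : 0 < t) (hl : 0 < lam) (h : lam < t)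
      (h' : t * (1 - c) ^ 2 ≤ lam) :
      Approached t 1 lam ((1 - 2 * c ^ 2) ^ n * (1 + (1 - c) ^ 2) * (t / (lam + t))) := by
    refine (attained_one ht.le zero_le_one le_rfl hl.le (by linarith)).approached.mono ?_
    have h1 : (1 - 2 * c ^ 2) ^ n ≤ 1 := pow_le_one₀ hc3 (by nlinarith)
    have h2 : (1 + (1 - c) ^ 2) * (t / (lam + t)) ≤ 1 := by
      rw [← mul_div_assoc, div_le_one (by positivity)]
      linarith
    rw [mul_assoc]
    exact mul_le_one₀ h1 (by positivity) h2
  induction n generalizing t lam with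
  | zero => exact top 0 ht hl (by simpa using h) h'
  | succ n ih =>
    rcases lt_or_ge lam t with hlt | hle
    · exact top _ ht hl hlt h'
    have h1 : 0 < 1 - c := by linarith
    have hl' : 0 < lam - c * t := by nlinarith
    have key := ih (t := t / (1 - c)) (lam := lam - c * t) (by positivity) hl' (by
      rw [lt_div_iff₀ h1, mul_assoc, ← pow_succ]
      refine lt_of_le_of_lt (mul_le_mul_of_nonneg_right ?_ (by positivity)) h
      nlinarith) (by
      rw [pow_two, ← mul_assoc, div_mul_cancel₀ _ h1.ne']
      linarith)
    refine (key.step hc (by linarith) hl'.le).mono ?_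
    have e : (1 - c) * ((1 - 2 * c ^ 2) ^ n * (1 + (1 - c) ^ 2) *
        (t / (1 - c) / (lam - c * t + t / (1 - c)))) = (1 - 2 * c ^ 2) ^ n * (1 + (1 - c) ^ 2) *
        (t / (lam - c * t + t / (1 - c))) := by
      field_simp
    rw [e, pow_succ, mul_assoc, mul_assoc, mul_assoc]
    refine mul_le_mul_of_nonneg_left ?_ (by positivity)
    rw [mul_left_comm]
    refine mul_le_mul_of_nonneg_left ?_ (by positivity)
    rw [← mul_div_assoc, div_le_div_iff₀ (by positivity) (by positivity)]
    -- Here (1 - c) * (1 + c + 2 * c ^ 2) = 1 + c ^ 2 * (1 - 2 * c), which is at least 1 because c ≤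
    -- 1 / 2.
    have h4 : t / (1 - c) ≤ t * (1 + c + 2 * c ^ 2) := by
      rw [div_le_iff₀ h1, mul_assoc]
      refine le_mul_of_one_le_right ht.le ?_
      nlinarith [mul_nonneg (sq_nonneg c) (show 0 ≤ 1 - 2 * c by linarith)]
    have h5 : (1 - 2 * c ^ 2) * (lam - c * t + t / (1 - c)) ≤ lam + t := by
      have h6 : lam - c * t + t / (1 - c) ≤ (lam + t) * (1 + 2 * c ^ 2) := by nlinarith
      refine (mul_le_mul_of_nonneg_left h6 hc3).trans ?_
      nlinarith [mul_nonneg (add_pos hl ht).le (sq_nonneg (c ^ 2))]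
    nlinarith

theorem approached_full_mass {t lam : ℝ} (ht : 0 < t) (h : t ≤ lam) :
    Approached t 1 lam (2 * t / (lam + t)) := by
  intro s hs
  have hl := ht.trans_le h
  -- With c = 1 / m and m * L steps, the ratio shrinks by at least exp (-L) < t / lam, while by
  -- Bernoulli's inequality the accumulated loss (1 - 2 / m ^ 2) ^ (m * L) is at least 1 - 2 * L /
  -- m, which tends to 1.
  obtain ⟨L, hL⟩ := exists_nat_gt (Real.log (lam / t))
  have lim : Filter.Tendsto (fun m : ℕ => (1 - 2 * L * (1 / (m : ℝ))) *
      (1 + (1 - 1 / (m : ℝ)) ^ 2) * (t / (lam + t))) Filter.atTop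
      (nhds ((1 - 2 * L * 0) * (1 + (1 - 0) ^ 2) * (t / (lam + t)))) := by
    have := tendsto_one_div_atTop_nhds_zero_nat (𝕜 := ℝ)
    exact ((tendsto_const_nhds.sub (this.const_mul _)).mul
      (tendsto_const_nhds.add ((tendsto_const_nhds.sub this).pow 2))).mul_const _
  have hs' : s < (1 - 2 * L * 0) * (1 + (1 - 0) ^ 2) * (t / (lam + t)) := by
    convert hs using 1
    ring
  obtain ⟨m, hm, hm2⟩ := ((lim.eventually (lt_mem_nhds hs')).and
    (Filter.eventually_ge_atTop 2)).exists
  have hm0 : (2 : ℝ) ≤ m := by exact_mod_cast hm2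
  have hm1 : 1 / (m : ℝ) ≤ 1 / 2 := one_div_le_one_div_of_le two_pos hm0
  have hmp : 0 < 1 / (m : ℝ) := by positivity
  refine approached_iterate hmp.le hm1 (m * L) ht hl ?_ ?_ s (hm.trans_le ?_)
  · have h1 : (1 - 1 / (m : ℝ)) ^ (m * L) ≤ Real.exp (-L) := by
      have h2 : 1 - 1 / (m : ℝ) ≤ Real.exp (-(1 / (m : ℝ))) := Real.one_sub_le_exp_neg _
      refine (pow_le_pow_left₀ (by linarith) h2 _).trans_eq ?_
      rw [← Real.exp_nat_mul]
      congr 1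
      push_cast
      field_simp
    refine (mul_le_mul_of_nonneg_left h1 hl.le).trans_lt ?_
    rw [Real.exp_neg, ← div_eq_mul_inv, div_lt_comm₀ (Real.exp_pos _) ht]
    exact (Real.log_lt_iff_lt_exp (by positivity)).1 hL
  · refine (mul_le_of_le_one_right ht.le ?_).trans h
    exact pow_le_one₀ (by linarith) (by linarith)
  · refine mul_le_mul_of_nonneg_right (mul_le_mul_of_nonneg_right ?_ (by positivity))
      (by positivity)
    have := one_add_mul_le_pow (a := -(2 * (1 / (m : ℝ)) ^ 2)) (by nlinarith) (m * L)
    refine le_trans (le_of_eq ?_) (this.trans_eq ?_)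
    · push_cast
      field_simp
      ring
    · ring

theorem approached_bellman {t A lam : ℝ} (ht : 0 < t) (hA : 0 < A) (hA1 : A ≤ 1) (hl : 0 < lam) :
    Approached t A lam (if t ≤ A * lam ∧ A * lam ≤ lam then 2 * A * t / (A * lam + t)
      else if A ≤ min (t / lam) (lam / t) then √(A * t / lam) else 1) := by
  have hAl : A * lam ≤ lam := by nlinarith
  split_ifs with h1 h2
  · have := (approached_full_mass (t := t / A) (lam := lam) (by positivity)
      ((div_le_iff₀' hA).2 h1.1)).scale zero_le_one le_rfl hl.le hA hA1
    rw [mul_div_cancel₀ _ hA.ne', mul_one] at this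
    refine this.mono (le_of_eq ?_)
    field_simp
  · have h3 : A * lam < t := not_le.1 fun h => h1 ⟨h, hAl⟩
    have h4 : A * t ≤ lam := (le_div_iff₀ ht).1 (h2.trans (min_le_right _ _))
    have h5 : A < √(A * t / lam) := by
      rw [Real.lt_sqrt hA.le, lt_div_iff₀ hl]
      nlinarith
    intro s hs
    -- Constant data (t / θ, A / θ) exceed the level exactly when θ is below the square root, and
    -- have mass at most 1 when θ ≥ A; concentrating them on the proportion θ restores (t, A).
    obtain ⟨θ, hθ1, hθ2⟩ := exists_between (max_lt hs h5)
    obtain ⟨hsθ, hAθ⟩ := max_lt_iff.1 hθ1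
    have hθ := hA.trans hAθ
    have hsq : θ ^ 2 * lam < A * t := (lt_div_iff₀ hl).1 ((Real.lt_sqrt hθ.le).1 hθ2)
    have := (attained_one (t := t / θ) (A := A / θ) (lam := lam) (by positivity) (by positivity)
      ((div_le_one hθ).2 hAθ.le) hl.le (by
        rw [div_mul_div_comm, lt_div_iff₀ (by positivity)]
        linarith)).scale (s := s) (θ := θ) (by positivity) ((div_le_one hθ).2 hAθ.le) hl.le hθ.le
        (hθ2.le.trans (Real.sqrt_le_one.2 ((div_le_one hl).2 h4))) (by linarith)
    rwa [mul_div_cancel₀ _ hθ.ne', mul_div_cancel₀ _ hθ.ne'] at this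
  · refine (attained_one ht.le hA.le hA1 hl.le ?_).approached
    by_contra! h
    have h3 : A * lam < t := not_le.1 fun h => h1 ⟨h, hAl⟩
    exact h2 (le_min ((le_div_iff₀ hl).2 h3.le) ((le_div_iff₀ ht).2 h))

end LernerOperator

theorem theorem1 (a b : ℝ) (hab : a < b) (t A lam : ℝ) (ht : 0 < t) (hA : 0 < A) (hA1 : A ≤ 1)
    (hlam : 0 < lam) :
    IsLUB
      {r : ℝ | ∃ (f : ℝ → ℝ) (α : List Bool → ℝ), LernerOperator.Admissible a b t A f α ∧
        r = (MeasureTheory.volume {x : ℝ | x ∈ Set.Ico a b ∧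
          ENNReal.ofReal lam < LernerOperator.lernerOp a b α f x}).toReal / (b - a)}
      (if t ≤ A * lam ∧ A * lam ≤ lam then 2 * A * t / (A * lam + t)
        else if A ≤ min (t / lam) (lam / t) then Real.sqrt (A * t / lam)
        else 1) := by
  have hba : 0 < b - a := sub_pos.2 hab
  constructor
  · rintro _ ⟨f, α, had, rfl⟩
    rw [← LernerOperator.bellman_eq ht hA hA1 hlam, div_le_iff₀' hba]
    exact ENNReal.toReal_le_of_le_ofReal
      (mul_nonneg hba.le (LernerOperator.bellman_nonneg ht.le hA.le hlam.le))
      (LernerOperator.volume_levelSet_le_bellman hab had hA.le hlam)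
  · intro M hM
    refine le_of_forall_lt_imp_le_of_dense fun s hs => ?_
    obtain ⟨f, α, had, hv⟩ := LernerOperator.approached_bellman ht hA hA1 hlam s hs a b hab
    refine le_trans ?_ (hM ⟨f, α, had, rfl⟩)
    rw [le_div_iff₀ hba]
    refine (ENNReal.ofReal_le_iff_le_toReal ?_).1 hv
    exact ((LernerOperator.volume_levelSet_le a b α f lam).trans_lt ENNReal.ofReal_lt_top).ne
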